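/- Let $1\le d<n$ and let $G_{d,n}$ be the Grassmannian of $d$-dimensional subspaces of $\mathbb R^n$ with the distance $\|P-Q\|$ (operator norm of the difference of the orthogonal projections). A $d$-varifold is a Radon measure $V$ on $\mathbb R^n\times G_{d,n}$; its mass $\|V\|$ is its image under $(x,P)\mapsto x$. It is rectifiable, $V=v(M,\theta)$, if $V=\theta\mathcal H^d|_M\otimes\delta_{T_xM}$ with $M$ countably $d$-rectifiable and $\mathcal H^d$-measurable, $\theta\ge 0$ measurable with $\theta>0$ $\mathcal H^d$-a.e. on $M$, and $T_xM$ the approximate tangent space. For $U\subset\mathbb R^n$ open and varifolds $V,W$ of finite mass put $$\Delta^{1,1}_U(V,W)=\sup\Big\{\Big|\int\varphi\,dV-\int\varphi\,dW\Big| : |\varphi|\le 1,\ \operatorname{supp}\varphi\subset U\times G_{d,n},\ |\varphi(x,P)-\varphi(y,Q)|\le|x-y|+\|P-Q\|\Big\},$$ and $\Delta^{1,1}=\Delta^{1,1}_{\mathbb R^n}$. For $A\subset\mathbb R^n$ and $s>0$ let $A^s=\{y: d(y,A)<s\}$. A mesh of $\mathbb R^n$ is a partition $\mathcal K$ of $\mathbb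 R^n$ into nonempty Borel cells, only finitely many of which meet any given bounded set; its size is $\sup_{K\in\mathcal K}\operatorname{diam}K$. A volumetric varifold on $\mathcal K$ is a varifold $\sum_K \frac{m_K}{|K|}\mathcal L^n|_K\otimes\delta_{P_K}$, and a point cloud varifold on $\mathcal K$ is a varifold $\sum_K m_K\,\delta_{x_K}\otimes\delta_{P_K}$ with $x_K\in K$; both sums run over finitely many cells $K\in\mathcal K$, with $m_K\ge 0$ and $P_K\in G_{d,n}$. Volumetric varifolds are considered only on meshes all of whose cells have positive Lebesgue measure. For $\beta\in(0,1]$, $V$ is piecewise $C^{1,\beta}$ if $V=v(S,\theta)$ for some $S$, $\theta$ as above and there are $R>0$, $C\ge1$ and a closed set $\Sigma\subset S$ with: - $C^{-1}r^d\le\mathcal H^d(S\cap B(x,r))\le Cr^d$ for all $x\in S$, $0<r<R$; - $C^{-1}r^{d-1}\le\mathcal H^{d-1}(\Sigma\cap B(z,r))\le Cr^{d-1}$ for all $z\in\Sigma$, $0<r<R$; - for all $0<r<R$ and $x\in S$ with $d(x,\Sigma)>Cr$ (where $d(x,\emptyset)=\infty$): $\|T_yS-T_zS\|\le Cr^\beta$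 for $\mathcal H^d$-almost all $y,z\in S\cap B(x,r)$; - $C^{-1}r\,\mathcal H^{d-1}(\Sigma\cap B(z,\epsilon))\le\mathcal H^d(S\cap\Sigma^r\cap B(z,\epsilon))\le Cr\,\mathcal H^{d-1}(\Sigma\cap B(z,\epsilon))$ for all $0<r<\epsilon<R$, $z\in\Sigma$; - $C^{-1}\le\theta\le C$ $\mathcal H^d$-a.e. on $S$. **Theorem.** Let $(\mathcal K_i)_{i\in\mathbb N}$ be meshes of $\mathbb R^n$ of finite sizes $\delta_i$, and let $V$ be a rectifiable $d$-varifold in $\mathbb R^n$ with $\|V\|(\mathbb R^n)<\infty$. Then there is a sequence $(V_i)$ of point cloud varifolds $V_i$ on $\mathcal K_i$ and, if all cells of all $\mathcal K_i$ have positive Lebesgue measure, also a sequence $(V_i)$ of volumetric varifolds $V_i$ on $\mathcal K_i$, such that each of these sequences has the following properties. (i) If $\delta_i\to0$, then $\Delta^{1,1}(V_i,V)\to0$. (ii) For every $\beta\in(0,1]$ such that $V$ is piecewise $C^{1,\beta}$ there are constants $C,R>0$ such that for all $i$ and all open balls $B$ of radius $r_B\in(0,R)$ centered on the support of $\|V\|$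 $$\Delta^{1,1}_B(V_i,V)\le C\Big(\delta_i^\beta+\frac{\delta_i}{r_B+\delta_i}\Big)\|V\|(B^{C\delta_i}),$$ and for all $i$ $$\Delta^{1,1}(V_i,V)\le C\Big(\delta_i^\beta+\frac{\delta_i}{R}\Big)\|V\|(\mathbb R^n).$$ -/

import Mathlib

open MeasureTheory Filter Topology Set
open scoped NNReal ENNReal

noncomputable section

namespace DiscreteVarifold

/-- The Euclidean space `ℝⁿ`. -/
abbrev E (n : ℕ) : Type := EuclideanSpace ℝ (Fin n)

/-- The Grassmannian of `d`-dimensional vector subspaces of `ℝⁿ`. -/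
def Grass (n d : ℕ) : Type := {P : Submodule ℝ (E n) // Module.finrank ℝ P = d}

namespace Grass

variable {n d : ℕ}

/-- The orthogonal projection onto `P`, as an endomorphism of `ℝⁿ`. -/
def proj (P : Grass n d) : E n →L[ℝ] E n := P.1.starProjection

theorem proj_injective : Function.Injective (proj : Grass n d → (E n →L[ℝ] E n)) := by
  intro P Q h
  exact Subtype.ext (Submodule.starProjection_inj.mp h)

/-- The distance of two planes is the operator norm of the difference of the orthogonal
projections. -/
instance : MetricSpace (Grass n d) := MetricSpace.induced proj proj_injective inferInstance

theorem dist_eq (P Q : Grass n d) : dist P Q = ‖proj P - proj Q‖ := by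
  rw [← dist_eq_norm]
  rfl

instance : MeasurableSpace (Grass n d) := borel _

instance : BorelSpace (Grass n d) := ⟨rfl⟩

end Grass

/-- A `d`-varifold in `ℝⁿ` is a (Radon) measure on `ℝⁿ × G(d,n)`. All varifolds below have
finite mass, hence are finite Borel measures, which are automatically Radon. -/
abbrev Varifold (n d : ℕ) : Type := Measure (E n × Grass n d)

/-- The mass `‖V‖`, the image of `V` under `(x, P) ↦ x`. -/
def mass {n d : ℕ} (V : Varifold n d) : Measure (E n) := V.map Prod.fst

/-- Test functions for the bounded Lipschitz distance localized in `U`: `1`-Lipschitz functions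
`φ` on `ℝⁿ × G(d,n)` with `|φ| ≤ 1` and support in `U × G(d,n)`. The Lipschitz condition refers
to the metric `|x - y| + ‖P - Q‖` of the product. -/
def IsTestFunction {n d : ℕ} (U : Set (E n)) (φ : E n × Grass n d → ℝ) : Prop :=
  (∀ p q, |φ p - φ q| ≤ dist p.1 q.1 + dist p.2 q.2) ∧
  (∀ p, |φ p| ≤ 1) ∧
  tsupport φ ⊆ U ×ˢ univ

/-- The bounded Lipschitz distance `Δ^{1,1}_U (V, W)` of two varifolds of finite mass, localized
in the open set `U`. -/
def flatDist {n d : ℕ} (U : Set (E n)) (V W : Varifold n d) : ℝ≥0∞ :=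
  ⨆ (φ : E n × Grass n d → ℝ) (_ : IsTestFunction U φ),
    ENNReal.ofReal |∫ p, φ p ∂V - ∫ p, φ p ∂W|

/-- `M` is countably `d`-rectifiable: it is covered, up to an `ℋᵈ`-null set, by countably many
Lipschitz images of `ℝᵈ`. -/
def CountablyRectifiable {n : ℕ} (d : ℕ) (M : Set (E n)) : Prop :=
  ∃ f : ℕ → E d → E n, (∀ j, ∃ L : ℝ≥0, LipschitzWith L (f j)) ∧
    μH[(d : ℝ)] (M \ ⋃ j, range (f j)) = 0

/-- `P` is the approximate tangent space at `x` of `M` (with respect to the multiplicity `θ`):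
for all `φ ∈ C_c(ℝⁿ)`,
`r⁻ᵈ ∫_M φ((y - x)/r) θ(y) dℋᵈ(y) → θ(x) ∫_P φ dℋᵈ` as `r → 0⁺`. -/
def IsApproxTangent {n d : ℕ} (M : Set (E n)) (θ : E n → ℝ≥0) (x : E n) (P : Grass n d) : Prop :=
  ∀ φ : E n → ℝ, Continuous φ → HasCompactSupport φ →
    Tendsto (fun r : ℝ => (r ^ d)⁻¹ * ∫ y in M, φ (r⁻¹ • (y - x)) * (θ y : ℝ) ∂μH[(d : ℝ)])
      (𝓝[>] 0) (𝓝 ((θ x : ℝ) * ∫ y in (P.1 : Set (E n)), φ y ∂μH[(d : ℝ)]))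

/-- `V = v(M, θ)` is the rectifiable `d`-varifold `θ ℋᵈ|_M ⊗ δ_{T_x M}`, with `T x = T_x M`
for `ℋᵈ`-almost every `x ∈ M`. -/
structure IsRectifiableWith {n d : ℕ} (M : Set (E n)) (θ : E n → ℝ≥0) (T : E n → Grass n d)
    (V : Varifold n d) : Prop where
  measurable_set : NullMeasurableSet M μH[(d : ℝ)]
  rectifiable : CountablyRectifiable d M
  measurable_mult : AEMeasurable θ (μH[(d : ℝ)].restrict M)
  mult_pos : ∀ᵐ x ∂(μH[(d : ℝ)].restrict M), 0 < θ x
  measurable_tangent : Measurable T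
  tangent : ∀ᵐ x ∂(μH[(d : ℝ)].restrict M), IsApproxTangent M θ x (T x)
  eq_map : V = ((μH[(d : ℝ)].restrict M).withDensity fun x => (θ x : ℝ≥0∞)).map
    fun x => (x, T x)

/-- `V` is a rectifiable `d`-varifold. -/
def IsRectifiable {n d : ℕ} (V : Varifold n d) : Prop :=
  ∃ (M : Set (E n)) (θ : E n → ℝ≥0) (T : E n → Grass n d), IsRectifiableWith M θ T V

/-- The conditions on `S` (with multiplicity `θ` and tangent planes `T y = T_y S`), on the
singular set `Σ = Sing`, and on the constants `C`, `R` that make up piecewise `C^{1,β}`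
regularity. As `T_y S` is defined for almost every `y ∈ S`, the supremum of `‖T_y S - T_z S‖`
is an essential supremum. -/
structure PiecewiseC1Data {n d : ℕ} (β C R : ℝ) (S : Set (E n)) (θ : E n → ℝ≥0)
    (T : E n → Grass n d) (Sing : Set (E n)) : Prop where
  isClosed_sing : IsClosed Sing
  sing_subset : Sing ⊆ S
  ahlfors : ∀ x ∈ S, ∀ r : ℝ, 0 < r → r < R →
    ENNReal.ofReal (C⁻¹ * r ^ d) ≤ μH[(d : ℝ)] (S ∩ Metric.ball x r) ∧
    μH[(d : ℝ)] (S ∩ Metric.ball x r) ≤ ENNReal.ofReal (C * r ^ d)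
  ahlfors_sing : ∀ z ∈ Sing, ∀ r : ℝ, 0 < r → r < R →
    ENNReal.ofReal (C⁻¹ * r ^ (d - 1)) ≤ μH[(d : ℝ) - 1] (Sing ∩ Metric.ball z r) ∧
    μH[(d : ℝ) - 1] (Sing ∩ Metric.ball z r) ≤ ENNReal.ofReal (C * r ^ (d - 1))
  tangent_holder : ∀ r : ℝ, 0 < r → r < R →
    ∀ x ∈ S, ENNReal.ofReal (C * r) < Metric.infEDist x Sing →
      ∀ᵐ y ∂(μH[(d : ℝ)].restrict (S ∩ Metric.ball x r)),
        ∀ᵐ z ∂(μH[(d : ℝ)].restrict (S ∩ Metric.ball x r)), dist (T y) (T z) ≤ C * r ^ β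
  tube : ∀ r ε : ℝ, 0 < r → r < ε → ε < R → ∀ z ∈ Sing,
    ENNReal.ofReal (C⁻¹ * r) * μH[(d : ℝ) - 1] (Sing ∩ Metric.ball z ε)
        ≤ μH[(d : ℝ)] (S ∩ Metric.thickening r Sing ∩ Metric.ball z ε) ∧
    μH[(d : ℝ)] (S ∩ Metric.thickening r Sing ∩ Metric.ball z ε)
        ≤ ENNReal.ofReal (C * r) * μH[(d : ℝ) - 1] (Sing ∩ Metric.ball z ε)
  mult_bounds : ∀ᵐ x ∂(μH[(d : ℝ)].restrict S), C⁻¹ ≤ (θ x : ℝ) ∧ (θ x : ℝ) ≤ C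

/-- The rectifiable varifold `V` is piecewise `C^{1,β}`. -/
def IsPiecewiseC1 {n d : ℕ} (β : ℝ) (V : Varifold n d) : Prop :=
  ∃ (S : Set (E n)) (θ : E n → ℝ≥0) (T : E n → Grass n d), IsRectifiableWith S θ T V ∧
    ∃ (R C : ℝ) (Sing : Set (E n)), 0 < R ∧ 1 ≤ C ∧ PiecewiseC1Data β C R S θ T Sing

/-- A mesh of `ℝⁿ`: a locally finite partition into nonempty Borel cells. -/
structure Mesh (n : ℕ) where
  cells : Set (Set (E n))
  nonempty : ∀ K ∈ cells, K.Nonempty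
  measurable : ∀ K ∈ cells, MeasurableSet K
  disjoint : cells.PairwiseDisjoint id
  cover : ⋃₀ cells = univ
  locallyFinite : ∀ B : Set (E n), Bornology.IsBounded B → {K ∈ cells | (K ∩ B).Nonempty}.Finite

/-- The size `sup_K diam K` of a mesh. -/
def Mesh.size {n : ℕ} (𝒦 : Mesh n) : ℝ≥0∞ := ⨆ K ∈ 𝒦.cells, Metric.ediam K

/-- `W = ∑_K (m_K / |K|) ℒⁿ|_K ⊗ δ_{P_K}` is a discrete volumetric varifold on the mesh `𝒦`,
described by finitely many parameters (`m_K = 0` for `K ∉ s`). -/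
def IsVolumetric {n d : ℕ} (𝒦 : Mesh n) (W : Varifold n d) : Prop :=
  ∃ (s : Finset (Set (E n))) (m : Set (E n) → ℝ≥0) (P : Set (E n) → Grass n d),
    (∀ K ∈ s, K ∈ 𝒦.cells) ∧
    W = ∑ K ∈ s, ((m K : ℝ≥0∞) / volume K) • (volume.restrict K).prod (Measure.dirac (P K))

/-- `W = ∑_K m_K δ_{x_K} ⊗ δ_{P_K}` is a point cloud varifold on the mesh `𝒦`: a finite weighted
sum of Dirac masses, with points `x_K ∈ K` in distinct cells `K` of `𝒦`. -/
def IsPointCloud {n d : ℕ} (𝒦 : Mesh n) (W : Varifold n d) : Prop :=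
  ∃ (s : Finset (Set (E n))) (x : Set (E n) → E n) (m : Set (E n) → ℝ≥0)
    (P : Set (E n) → Grass n d),
    (∀ K ∈ s, K ∈ 𝒦.cells ∧ x K ∈ K) ∧
    W = ∑ K ∈ s, (m K : ℝ≥0∞) • Measure.dirac (x K, P K)

/-- The approximation properties of a sequence `W` of varifolds built on meshes of sizes `δ`:
convergence to `V` in the bounded Lipschitz distance if `δ → 0`, and the localized and global
rates if `V` is piecewise `C^{1,β}`. -/
def Approximates {n d : ℕ} (δ : ℕ → ℝ≥0) (W : ℕ → Varifold n d) (V : Varifold n d) : Prop :=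
  (Tendsto δ atTop (𝓝 0) → Tendsto (fun i => flatDist univ (W i) V) atTop (𝓝 0)) ∧
  ∀ β : ℝ, 0 < β → β ≤ 1 → IsPiecewiseC1 β V →
    ∃ C R : ℝ, 0 < C ∧ 0 < R ∧ ∀ i,
      (∀ x ∈ (mass V).support, ∀ r : ℝ, 0 < r → r < R →
        flatDist (Metric.ball x r) (W i) V
          ≤ ENNReal.ofReal (C * ((δ i : ℝ) ^ β + δ i / (r + δ i)))
            * mass V (Metric.thickening (C * δ i) (Metric.ball x r))) ∧
      flatDist univ (W i) V ≤ ENNReal.ofReal (C * ((δ i : ℝ) ^ β + δ i / R)) * mass V univ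

end DiscreteVarifold

end

/-! Write `V` as the image of `μ = ‖V‖` under `x ↦ (x, T x)`. On each of finitely many cells `K`,
replace `μ` by `μ(K) ν_K`, with `ν_K` any probability measure on `K`, and `T` by one plane `P_K`. A
Dirac mass for `ν_K` gives point clouds, normalized Lebesgue measure gives volumetric varifolds, and
the estimates are the same for both. A cell costs at most `δ μ(K) + ∫_K ‖T - P_K‖ dμ` and never more
than `2 μ(K)` (`flatDist_cellVarifold_le`). Taking for `P_K` a value of `T` that is no worse than
average bounds the integral by the mean oscillation of `T` on `K`.

Convergence follows by approximating `T` in `L¹(μ)` by a uniformly continuous map, whose oscillation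
on small cells is small.

For the rates, a cell with a point of `S` at distance at least `3Cδ` from `Σ` has tangent planes
within a multiple of `δ^β` of each other; any other cell has its mass in the tube `Σ^{3Cδ}` and gets
the trivial bound (`ae_edist_le_or_measure_diff_eq_zero`). In a ball of radius `r` the tube has mass
of order `δ r^{d-1}`, a fraction `δ/r` of the mass of the ball (`measure_thickening_inter_le`).
Globally, a finite net of `Σ` bounds the tube by a multiple of `δ`. The planes and cells are chosen
without knowing `β`. -/

namespace DiscreteVarifold

variable {n d : ℕ}

/-! ### Basic facts on the Grassmannian and on test functions. -/

namespace Grass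

theorem isometry_proj : Isometry (proj : Grass n d → (E n →L[ℝ] E n)) := fun _ _ => rfl

instance : SecondCountableTopology (Grass n d) :=
  isometry_proj.isUniformInducing.isInducing.secondCountableTopology

theorem norm_proj_le_one (P : Grass n d) : ‖proj P‖ ≤ 1 :=
  Submodule.starProjection_norm_le _

end Grass

namespace IsTestFunction

variable {U : Set (E n)} {φ : E n × Grass n d → ℝ}

theorem continuous (hφ : IsTestFunction U φ) : Continuous φ := by
  refine (LipschitzWith.of_dist_le_mul (K := 2) fun p q => ?_).continuous
  rw [Real.dist_eq, Prod.dist_eq]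
  have h1 := le_max_left (dist p.1 q.1) (dist p.2 q.2)
  have h2 := le_max_right (dist p.1 q.1) (dist p.2 q.2)
  have := hφ.1 p q
  push_cast
  linarith

theorem eq_zero (hφ : IsTestFunction U φ) {x : E n} (hx : x ∉ U) (P : Grass n d) :
    φ (x, P) = 0 :=
  image_eq_zero_of_notMem_tsupport fun h => hx (hφ.2.2 h).1

theorem integrable (hφ : IsTestFunction U φ) (V : Varifold n d) [IsFiniteMeasure V] :
    Integrable φ V :=
  .of_bound hφ.continuous.aestronglyMeasurable 1 (.of_forall hφ.2.1)

theorem enorm_sub_le (hφ : IsTestFunction U φ) (p q : E n × Grass n d) :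
    ‖φ p - φ q‖ₑ ≤ edist p.1 q.1 + edist p.2 q.2 := by
  rw [edist_dist, edist_dist, ← ENNReal.ofReal_add dist_nonneg dist_nonneg,
    ← ofReal_norm]
  exact ENNReal.ofReal_le_ofReal (hφ.1 p q)

theorem enorm_le_one (hφ : IsTestFunction U φ) (p : E n × Grass n d) : ‖φ p‖ₑ ≤ 1 := by
  rw [← ofReal_norm]
  exact ENNReal.ofReal_le_one.2 (hφ.2.1 p)

end IsTestFunction

/-! ### Cell-by-cell estimate of the bounded Lipschitz distance. -/

/-- The varifold `∑_K μ(K) ν_K ⊗ δ_{P_K}`. -/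
noncomputable def cellVarifold (μ : Measure (E n)) (s : Finset (Set (E n))) (ν : Set (E n) → Measure (E n))
    (P : Set (E n) → Grass n d) : Varifold n d :=
  ∑ K ∈ s, μ K • (ν K).prod (Measure.dirac (P K))

/-- A bound for the contribution of the cell `K` to the bounded Lipschitz distance between
`x ↦ (x, T x)` pushed forward by `μ` and a discretization with plane `P` on `K`. -/
noncomputable def cellError (μ : Measure (E n)) (T : E n → Grass n d) (δ : ℝ≥0∞) (K : Set (E n))
    (P : Grass n d) : ℝ≥0∞ :=
  min (2 * μ K) (δ * μ K + ∫⁻ x in K, edist (T x) P ∂μ)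

/-- As `ν` is a probability measure, the difference is the double integral of `φ (x, T x) - φ (y,
P)` over `x ∈ K` and `y`. The bound `|φ| ≤ 1` gives one term of the minimum. The Lipschitz condition
gives the other, since `ν` lives on `K`. -/
theorem enorm_setIntegral_sub_le_cellError {μ ν : Measure (E n)} [IsFiniteMeasure μ]
    [IsProbabilityMeasure ν] {T : E n → Grass n d} (hT : Measurable T) {K : Set (E n)}
    (hK : MeasurableSet K) {δ : ℝ≥0∞} (hδ : Metric.ediam K ≤ δ) (hν : ν Kᶜ = 0)
    {U : Set (E n)} {φ : E n × Grass n d → ℝ} (hφ : IsTestFunction U φ) (P : Grass n d) :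
    ‖(∫ x in K, φ (x, T x) ∂μ) - (μ K).toReal * ∫ y, φ (y, P) ∂ν‖ₑ ≤ cellError μ T δ K P := by
  have hφc := hφ.continuous
  have hi : Integrable (fun y => φ (y, P)) ν :=
    .of_bound (by fun_prop) 1 (.of_forall fun y => hφ.2.1 _)
  have hi' : Integrable (fun x => φ (x, T x)) (μ.restrict K) :=
    .of_bound ((hφc.measurable.comp (measurable_id.prodMk hT)).aestronglyMeasurable) 1
      (.of_forall fun y => hφ.2.1 _)
  have hKν : ∀ᵐ y ∂ν, y ∈ K := by
    rw [ae_iff]; exact hν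
  have key : (∫ x in K, φ (x, T x) ∂μ) - (μ K).toReal * ∫ y, φ (y, P) ∂ν
      = ∫ x in K, ∫ y, (φ (x, T x) - φ (y, P)) ∂ν ∂μ := by
    have h1 : ∀ x, ∫ y, (φ (x, T x) - φ (y, P)) ∂ν = φ (x, T x) - ∫ y, φ (y, P) ∂ν := by
      intro x
      rw [integral_sub (integrable_const _) hi]
      simp
    simp_rw [h1]
    rw [integral_sub hi' (integrable_const _)]
    simp [Measure.real]
  rw [key]
  refine (enorm_integral_le_lintegral_enorm _).trans (le_min ?_ ?_)
  · calc ∫⁻ x in K, ‖∫ y, (φ (x, T x) - φ (y, P)) ∂ν‖ₑ ∂μ ≤ ∫⁻ x in K, 2 ∂μ := by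
          refine lintegral_mono fun x => (enorm_integral_le_lintegral_enorm _).trans ?_
          calc ∫⁻ y, ‖φ (x, T x) - φ (y, P)‖ₑ ∂ν ≤ ∫⁻ y, 2 ∂ν := by
                refine lintegral_mono fun y => enorm_sub_le.trans ?_
                rw [← one_add_one_eq_two]
                exact add_le_add (hφ.enorm_le_one _) (hφ.enorm_le_one _)
            _ = 2 := by simp
      _ = 2 * μ K := by simp
  · calc ∫⁻ x in K, ‖∫ y, (φ (x, T x) - φ (y, P)) ∂ν‖ₑ ∂μ
        ≤ ∫⁻ x in K, (δ + edist (T x) P) ∂μ := by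
          refine setLIntegral_mono' hK fun x hx => (enorm_integral_le_lintegral_enorm _).trans ?_
          calc ∫⁻ y, ‖φ (x, T x) - φ (y, P)‖ₑ ∂ν ≤ ∫⁻ y, (δ + edist (T x) P) ∂ν := by
                refine lintegral_mono_ae (hKν.mono fun y hy => (hφ.enorm_sub_le _ _).trans ?_)
                exact add_le_add ((Metric.edist_le_ediam_of_mem hx hy).trans hδ) le_rfl
            _ = δ + edist (T x) P := by simp
      _ = δ * μ K + ∫⁻ x in K, edist (T x) P ∂μ := by
          rw [lintegral_add_left measurable_const]; simp

/-- This localizes the estimate: only cells that meet `U` count, and these lie in a small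
neighbourhood of `U`. -/
theorem setIntegral_sub_eq_zero_of_disjoint {μ ν : Measure (E n)} {T : E n → Grass n d}
    {K : Set (E n)} (hν : ν Kᶜ = 0) {U : Set (E n)}
    {φ : E n × Grass n d → ℝ} (hφ : IsTestFunction U φ) (P : Grass n d)
    (hKU : ¬ (K ∩ U).Nonempty) :
    (∫ x in K, φ (x, T x) ∂μ) - (μ K).toReal * ∫ y, φ (y, P) ∂ν = 0 := by
  have hz : ∀ x ∈ K, ∀ Q, φ (x, Q) = 0 := fun x hx Q => hφ.eq_zero (fun hU => hKU ⟨x, hx, hU⟩) Q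
  have hKν : ∀ᵐ y ∂ν, y ∈ K := by
    rw [ae_iff]; exact hν
  rw [setIntegral_eq_zero_of_forall_eq_zero fun x hx => hz x hx _,
    integral_eq_zero_of_ae (hKν.mono fun y hy => hz y hy _)]
  simp

/-- The basic estimate of the bounded Lipschitz distance to a discretization. -/
theorem flatDist_cellVarifold_le {μ : Measure (E n)} [IsFiniteMeasure μ] {T : E n → Grass n d}
    (hT : Measurable T) {s : Finset (Set (E n))} (hdis : (s : Set (Set (E n))).PairwiseDisjoint id)
    (hmeas : ∀ K ∈ s, MeasurableSet K) {δ : ℝ≥0∞} (hδ : ∀ K ∈ s, Metric.ediam K ≤ δ)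
    {ν : Set (E n) → Measure (E n)} (hν : ∀ K ∈ s, IsProbabilityMeasure (ν K) ∧ ν K Kᶜ = 0)
    (P : Set (E n) → Grass n d) (U : Set (E n)) [DecidablePred fun K => (K ∩ U).Nonempty] :
    flatDist U (cellVarifold μ s ν P) (μ.map fun x => (x, T x))
      ≤ ∑ K ∈ s with (K ∩ U).Nonempty, cellError μ T δ K (P K) + μ (⋃ K ∈ s, K)ᶜ := by
  refine iSup₂_le fun φ hφ => ?_
  have hTm : Measurable fun x => (x, T x) := measurable_id.prodMk hT
  have hφc := hφ.continuous
  have hi : Integrable (fun x => φ (x, T x)) μ :=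
    .of_bound ((hφc.measurable.comp hTm).aestronglyMeasurable) 1 (.of_forall fun y => hφ.2.1 _)
  have hA : MeasurableSet (⋃ K ∈ s, K) := s.measurableSet_biUnion hmeas
  have hV : ∫ p, φ p ∂(μ.map fun x => (x, T x))
      = ∑ K ∈ s, ∫ x in K, φ (x, T x) ∂μ + ∫ x in (⋃ K ∈ s, K)ᶜ, φ (x, T x) ∂μ := by
    rw [integral_map hTm.aemeasurable hφc.aestronglyMeasurable, ← integral_add_compl hA hi,
      integral_biUnion_finset s hmeas hdis fun K _ => hi.integrableOn]
  have hW : ∫ p, φ p ∂(cellVarifold μ s ν P)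
      = ∑ K ∈ s, (μ K).toReal * ∫ y, φ (y, P K) ∂(ν K) := by
    rw [cellVarifold, integral_finsetSum_measure]
    · refine Finset.sum_congr rfl fun K hK => ?_
      have := (hν K hK).1
      rw [integral_smul_measure, Measure.prod_dirac,
        integral_map (by fun_prop) hφc.aestronglyMeasurable, smul_eq_mul]
    · intro K hK
      have := (hν K hK).1
      exact (hφ.integrable _).smul_measure (measure_ne_top _ _)
  rw [abs_sub_comm, hV, hW, ← Real.norm_eq_abs, ofReal_norm, add_sub_right_comm,
    ← Finset.sum_sub_distrib]
  refine (enorm_add_le _ _).trans (add_le_add ?_ ?_)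
  · refine (enorm_sum_le _ _).trans ?_
    rw [Finset.sum_filter]
    refine Finset.sum_le_sum fun K hK => ?_
    have := (hν K hK).1
    split_ifs with h
    · exact enorm_setIntegral_sub_le_cellError hT (hmeas K hK) (hδ K hK) (hν K hK).2 hφ _
    · rw [setIntegral_sub_eq_zero_of_disjoint (hν K hK).2 hφ _ h, enorm_zero]
  · refine (enorm_integral_le_lintegral_enorm _).trans ?_
    refine (lintegral_mono fun x => hφ.enorm_le_one _).trans ?_
    simp

theorem measurable_edist_comp {T : E n → Grass n d} (hT : Measurable T) :
    Measurable fun p : E n × E n => edist (T p.2) (T p.1) :=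
  (hT.comp measurable_snd).edist (hT.comp measurable_fst)

/-! ### Choice of the planes and mean oscillation of the tangent map. -/

/-- Some plane is, in the mean over `K`, as close to `T` as the values of `T` among themselves. -/
theorem exists_mul_lintegral_edist_le (μ : Measure (E n)) [IsFiniteMeasure μ]
    {T : E n → Grass n d} (hT : Measurable T) (K : Set (E n)) :
    ∃ P : Grass n d, μ K * ∫⁻ y in K, edist (T y) P ∂μ
      ≤ ∫⁻ x in K, ∫⁻ y in K, edist (T y) (T x) ∂μ ∂μ := by
  rcases eq_or_ne (μ K) 0 with h0 | h0
  -- Any plane will do on a null cell; `T 0` merely supplies one.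
  · exact ⟨T 0, by simp [h0]⟩
  obtain ⟨x, hx⟩ := exists_le_laverage (μ := μ.restrict K)
    (f := fun x => ∫⁻ y in K, edist (T y) (T x) ∂μ) (by simpa using h0)
    (measurable_edist_comp hT).lintegral_prod_right'.aemeasurable
  refine ⟨T x, ?_⟩
  rw [laverage_eq, Measure.restrict_apply_univ] at hx
  rw [mul_comm]
  exact (ENNReal.le_div_iff_mul_le (.inl h0) (.inl (measure_ne_top _ _))).1 hx

theorem le_of_mul_le_mul_measure {μ : Measure (E n)} [IsFiniteMeasure μ] {f : E n → ℝ≥0∞}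
    {K : Set (E n)} {a : ℝ≥0∞} (h : μ K * ∫⁻ y in K, f y ∂μ ≤ a * μ K) :
    ∫⁻ y in K, f y ∂μ ≤ a := by
  rcases eq_or_ne (μ K) 0 with h0 | h0
  · rw [setLIntegral_measure_zero _ _ h0]; exact zero_le
  · rw [mul_comm] at h
    exact (ENNReal.mul_le_mul_iff_left h0 (measure_ne_top _ _)).1 h

/-- Maps into the Grassmannian are approximated in the mean by uniformly continuous maps. -/
theorem exists_uniformContinuous_lintegral_enorm_sub_le (μ : Measure (E n)) [IsFiniteMeasure μ]
    {T : E n → Grass n d} (hT : Measurable T) {ε : ℝ≥0∞} (hε : ε ≠ 0) :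
    ∃ A : E n → (E n →L[ℝ] E n), UniformContinuous A ∧
      ∫⁻ x, ‖(T x).proj - A x‖ₑ ∂μ ≤ ε := by
  have hm : AEStronglyMeasurable (fun x => (T x).proj) μ :=
    (Grass.isometry_proj.continuous.comp_stronglyMeasurable
      hT.stronglyMeasurable).aestronglyMeasurable
  have hL : MemLp (fun x => (T x).proj) 1 μ :=
    .of_bound hm 1 (.of_forall fun x => Grass.norm_proj_le_one _)
  obtain ⟨A, hA, hle, hc, -⟩ := hL.exists_hasCompactSupport_eLpNorm_sub_le ENNReal.one_ne_top hε
  refine ⟨A, hA.uniformContinuous_of_continuous hc, ?_⟩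
  rwa [eLpNorm_one_eq_lintegral_enorm] at hle

/-- The oscillation of `T` on `K` in the mean, bounded through an approximation `A` of `T`. -/
theorem lintegral_edist_le_of_approx {μ : Measure (E n)} [IsFiniteMeasure μ]
    {T : E n → Grass n d} (hT : Measurable T) {A : E n → (E n →L[ℝ] E n)} (hA : Continuous A)
    {K : Set (E n)} (hK : MeasurableSet K) {ω : ℝ≥0∞}
    (hω : ∀ x ∈ K, ∀ y ∈ K, edist (A x) (A y) ≤ ω) :
    ∫⁻ x in K, ∫⁻ y in K, edist (T y) (T x) ∂μ ∂μ
      ≤ (2 * ∫⁻ x in K, ‖(T x).proj - A x‖ₑ ∂μ + ω * μ K) * μ K := by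
  have hm : Measurable fun x => ‖(T x).proj - A x‖ₑ :=
    (((Grass.isometry_proj.continuous.comp_stronglyMeasurable hT.stronglyMeasurable).sub
      hA.stronglyMeasurable).enorm)
  have hpt : ∀ x ∈ K, ∀ y ∈ K, edist (T y) (T x)
      ≤ ‖(T y).proj - A y‖ₑ + (ω + ‖(T x).proj - A x‖ₑ) := by
    intro x hx y hy
    calc edist (T y) (T x) = edist (T y).proj (T x).proj := rfl
      _ ≤ edist (T y).proj (A y) + (edist (A y) (A x) + edist (A x) (T x).proj) :=
        (edist_triangle _ _ _).trans (add_le_add le_rfl (edist_triangle _ _ _))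
      _ ≤ _ := by
        rw [edist_comm (A x), edist_eq_enorm_sub, edist_eq_enorm_sub (T x).proj]
        gcongr
        exact hω y hy x hx
  calc ∫⁻ x in K, ∫⁻ y in K, edist (T y) (T x) ∂μ ∂μ
      ≤ ∫⁻ x in K, ∫⁻ y in K, (‖(T y).proj - A y‖ₑ + (ω + ‖(T x).proj - A x‖ₑ)) ∂μ ∂μ :=
        setLIntegral_mono' hK fun x hx => setLIntegral_mono' hK fun y hy => hpt x hx y hy
    _ = ∫⁻ x in K, ((∫⁻ y in K, ‖(T y).proj - A y‖ₑ ∂μ + ω * μ K)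
          + ‖(T x).proj - A x‖ₑ * μ K) ∂μ := by
        refine lintegral_congr fun x => ?_
        rw [lintegral_add_left hm, lintegral_const, Measure.restrict_apply_univ, add_mul, add_assoc]
    _ = _ := by
        rw [lintegral_add_left measurable_const, lintegral_mul_const _ hm, lintegral_const,
          Measure.restrict_apply_univ]
        ring

theorem sum_measure_le {μ : Measure (E n)} {s : Finset (Set (E n))}
    (hdis : (s : Set (Set (E n))).PairwiseDisjoint id) (hmeas : ∀ K ∈ s, MeasurableSet K)
    {B : Set (E n)} (hB : ∀ K ∈ s, K ⊆ B) : ∑ K ∈ s, μ K ≤ μ B := by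
  rw [← measure_biUnion_finset (f := fun K => K) hdis hmeas]
  exact measure_mono (iUnion₂_subset hB)

/-- Thickenings are open while the diameter bound is not strict, hence the margin `δ < η`; it is
applied with `η = 2 * δ`. -/
theorem subset_thickening_of_ediam_le {K U : Set (E n)} {δ η : ℝ} (hη : 0 < η) (hδη : δ < η)
    (hK : Metric.ediam K ≤ ENNReal.ofReal δ) (hKU : (K ∩ U).Nonempty) :
    K ⊆ Metric.thickening η U := by
  obtain ⟨x, hxK, hxU⟩ := hKU
  intro y hy
  refine Metric.mem_thickening_iff_exists_edist_lt _ _ |>.2 ⟨x, hxU, ?_⟩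
  exact ((Metric.edist_le_ediam_of_mem hy hxK).trans hK).trans_lt
    ((ENNReal.ofReal_lt_ofReal_iff hη).2 hδη)

/-! ### Distance estimates for discretizations. -/

/-- The data of a discretization: finitely many cells of size at most `δ`, with reference
probability measures and nearly optimal planes. -/
structure IsDiscretization (μ : Measure (E n)) (T : E n → Grass n d) (δ : ℝ)
    (s : Finset (Set (E n))) (ν : Set (E n) → Measure (E n)) (P : Set (E n) → Grass n d) :
    Prop where
  disjoint : (s : Set (Set (E n))).PairwiseDisjoint id
  measurable : ∀ K ∈ s, MeasurableSet K
  ediam_le : ∀ K ∈ s, Metric.ediam K ≤ ENNReal.ofReal δ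
  reference : ∀ K ∈ s, IsProbabilityMeasure (ν K) ∧ ν K Kᶜ = 0
  plane : ∀ K, μ K * ∫⁻ y in K, edist (T y) (P K) ∂μ
    ≤ ∫⁻ x in K, ∫⁻ y in K, edist (T y) (T x) ∂μ ∂μ

namespace IsDiscretization

variable {μ : Measure (E n)} [IsFiniteMeasure μ] {T : E n → Grass n d} {δ : ℝ}
  {s : Finset (Set (E n))} {ν : Set (E n) → Measure (E n)} {P : Set (E n) → Grass n d}

open scoped Classical in
theorem flatDist_le (h : IsDiscretization μ T δ s ν P) (hT : Measurable T) (U : Set (E n)) :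
    flatDist U (cellVarifold μ s ν P) (μ.map fun x => (x, T x))
      ≤ ∑ K ∈ s with (K ∩ U).Nonempty, cellError μ T (ENNReal.ofReal δ) K (P K)
        + μ (⋃ K ∈ s, K)ᶜ :=
  flatDist_cellVarifold_le hT h.disjoint h.measurable h.ediam_le h.reference P U

/-- The estimate that yields convergence without regularity assumptions. -/
theorem flatDist_univ_le_of_approx (h : IsDiscretization μ T δ s ν P) (hT : Measurable T)
    {A : E n → (E n →L[ℝ] E n)} (hA : Continuous A) {ω : ℝ≥0∞}
    (hω : ∀ x y, edist x y ≤ ENNReal.ofReal δ → edist (A x) (A y) ≤ ω) :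
    flatDist univ (cellVarifold μ s ν P) (μ.map fun x => (x, T x))
      ≤ (ENNReal.ofReal δ + ω) * μ univ + 2 * ∫⁻ x, ‖(T x).proj - A x‖ₑ ∂μ
        + μ (⋃ K ∈ s, K)ᶜ := by
  classical
  refine (h.flatDist_le hT univ).trans (add_le_add ?_ le_rfl)
  have hK : ∀ K ∈ s, cellError μ T (ENNReal.ofReal δ) K (P K)
      ≤ (ENNReal.ofReal δ + ω) * μ K + 2 * ∫⁻ x in K, ‖(T x).proj - A x‖ₑ ∂μ := by
    intro K hK
    have := le_of_mul_le_mul_measure ((h.plane K).trans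
      (lintegral_edist_le_of_approx hT hA (h.measurable K hK) fun x hx y hy =>
        hω x y ((Metric.edist_le_ediam_of_mem hx hy).trans (h.ediam_le K hK))))
    refine (min_le_right _ _).trans ((add_le_add le_rfl this).trans_eq ?_)
    ring
  calc ∑ K ∈ s with (K ∩ univ).Nonempty, cellError μ T (ENNReal.ofReal δ) K (P K)
      ≤ ∑ K ∈ s, cellError μ T (ENNReal.ofReal δ) K (P K) :=
        Finset.sum_le_sum_of_subset (Finset.filter_subset _ _)
    _ ≤ ∑ K ∈ s, ((ENNReal.ofReal δ + ω) * μ K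
          + 2 * ∫⁻ x in K, ‖(T x).proj - A x‖ₑ ∂μ) := Finset.sum_le_sum hK
    _ = (ENNReal.ofReal δ + ω) * ∑ K ∈ s, μ K
          + 2 * ∫⁻ x in ⋃ K ∈ s, K, ‖(T x).proj - A x‖ₑ ∂μ := by
        rw [lintegral_biUnion_finset (t := fun K => K) h.disjoint h.measurable,
          Finset.sum_add_distrib, Finset.mul_sum, Finset.mul_sum]
    _ ≤ _ := by
        gcongr
        · exact sum_measure_le h.disjoint h.measurable fun K _ => subset_univ _
        · exact Measure.restrict_le_self

/-- The trivial bound, for scales at which `δ` is not small compared with the radius. -/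
theorem flatDist_le_two_mul (h : IsDiscretization μ T δ s ν P) (hT : Measurable T)
    (hs : μ (⋃ K ∈ s, K)ᶜ = 0) (hδ : 0 < δ) (U : Set (E n)) :
    flatDist U (cellVarifold μ s ν P) (μ.map fun x => (x, T x))
      ≤ 2 * μ (Metric.thickening (2 * δ) U) := by
  classical
  refine (h.flatDist_le hT U).trans ?_
  rw [hs, add_zero]
  calc ∑ K ∈ s with (K ∩ U).Nonempty, cellError μ T (ENNReal.ofReal δ) K (P K)
      ≤ ∑ K ∈ s with (K ∩ U).Nonempty, 2 * μ K := Finset.sum_le_sum fun K _ => min_le_left _ _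
    _ = 2 * ∑ K ∈ s with (K ∩ U).Nonempty, μ K := by rw [Finset.mul_sum]
    _ ≤ _ := by
      gcongr
      refine sum_measure_le (h.disjoint.subset (Finset.coe_subset.2 (Finset.filter_subset _ _))) (fun K hK => ?_) fun K hK => ?_
      · exact h.measurable K (Finset.mem_filter.1 hK).1
      · obtain ⟨hK, hKU⟩ := Finset.mem_filter.1 hK
        exact subset_thickening_of_ediam_le (by positivity) (by linarith) (h.ediam_le K hK) hKU

/-- Cells on which `T` is nearly constant contribute little; the others lie in `B`. -/
theorem flatDist_le_of_bad (h : IsDiscretization μ T δ s ν P) (hT : Measurable T)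
    (hs : μ (⋃ K ∈ s, K)ᶜ = 0) (hδ : 0 < δ) (U : Set (E n)) {c : ℝ≥0∞} {B : Set (E n)}
    (hB : ∀ K ∈ s, (∀ᵐ x ∂μ.restrict K, ∀ᵐ y ∂μ.restrict K, edist (T y) (T x) ≤ c) ∨
      μ (K \ B) = 0) (hBm : MeasurableSet B) :
    flatDist U (cellVarifold μ s ν P) (μ.map fun x => (x, T x))
      ≤ (ENNReal.ofReal δ + c) * μ (Metric.thickening (2 * δ) U)
        + 2 * μ (Metric.thickening (2 * δ) U ∩ B) := by
  classical
  refine (h.flatDist_le hT U).trans ?_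
  rw [hs, add_zero]
  -- A bad cell costs `2 μ(K)`, and all its mass lies in `B`. With `μ.restrict B` both terms are
  -- measures of `K`, so both add up over disjoint cells.
  have hK : ∀ K ∈ s, cellError μ T (ENNReal.ofReal δ) K (P K)
      ≤ (ENNReal.ofReal δ + c) * μ K + 2 * μ.restrict B K := by
    intro K hK
    rcases hB K hK with hg | hb
    · refine (min_le_right _ _).trans ?_
      rw [add_mul]
      refine (add_le_add le_rfl (le_of_mul_le_mul_measure ((h.plane K).trans ?_))).trans
        le_self_add
      calc ∫⁻ x in K, ∫⁻ y in K, edist (T y) (T x) ∂μ ∂μ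
          ≤ ∫⁻ x in K, ∫⁻ y in K, c ∂μ ∂μ :=
            lintegral_mono_ae (hg.mono fun x hx => lintegral_mono_ae hx)
        _ = c * μ K * μ K := by simp
    · refine (min_le_left _ _).trans (le_add_left ?_)
      rw [Measure.restrict_apply (h.measurable K hK), ← measure_inter_add_sdiff K hBm, hb, add_zero]
  calc ∑ K ∈ s with (K ∩ U).Nonempty, cellError μ T (ENNReal.ofReal δ) K (P K)
      ≤ ∑ K ∈ s with (K ∩ U).Nonempty, ((ENNReal.ofReal δ + c) * μ K + 2 * μ.restrict B K) :=
        Finset.sum_le_sum fun K hKf => hK K (Finset.mem_filter.1 hKf).1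
    _ = (ENNReal.ofReal δ + c) * ∑ K ∈ s with (K ∩ U).Nonempty, μ K
          + 2 * ∑ K ∈ s with (K ∩ U).Nonempty, μ.restrict B K := by
        rw [Finset.sum_add_distrib, Finset.mul_sum, Finset.mul_sum]
    _ ≤ _ := by
      have hsub : ∀ K ∈ s.filter (fun K => (K ∩ U).Nonempty),
          K ⊆ Metric.thickening (2 * δ) U := fun K hK => by
        obtain ⟨hK, hKU⟩ := Finset.mem_filter.1 hK
        exact subset_thickening_of_ediam_le (by positivity) (by linarith) (h.ediam_le K hK) hKU
      have hdis : ((s.filter fun K => (K ∩ U).Nonempty : Finset _) :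
          Set (Set (E n))).PairwiseDisjoint id := h.disjoint.subset (Finset.coe_subset.2 (Finset.filter_subset _ _))
      have hm : ∀ K ∈ s.filter (fun K => (K ∩ U).Nonempty), MeasurableSet K :=
        fun K hK => h.measurable K (Finset.mem_filter.1 hK).1
      rw [← Measure.restrict_apply Metric.isOpen_thickening.measurableSet]
      exact add_le_add (mul_le_mul_right (sum_measure_le hdis hm hsub) _)
        (mul_le_mul_right (sum_measure_le hdis hm hsub) _)

end IsDiscretization

/-! ### Mass and tangent planes as determined by the varifold. -/

theorem measurable_graph {T : E n → Grass n d} (hT : Measurable T) :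
    Measurable fun x => (x, T x) := measurable_id.prodMk hT

theorem mass_map_graph {μ : Measure (E n)} {T : E n → Grass n d} (hT : Measurable T) :
    mass (μ.map fun x => (x, T x)) = μ := by
  rw [mass, Measure.map_map measurable_fst (measurable_graph hT)]
  exact Measure.map_id

/-- A varifold determines its tangent planes almost everywhere. -/
theorem ae_eq_of_map_graph_eq {μ : Measure (E n)} {T T' : E n → Grass n d} (hT : Measurable T)
    (hT' : Measurable T') (h : μ.map (fun x => (x, T x)) = μ.map fun x => (x, T' x)) :
    T =ᵐ[μ] T' := by
  -- The complement of the graph of `T'` is null for the second image measure, hence for the first.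
  have hm : MeasurableSet {p : E n × Grass n d | p.2 ≠ T' p.1} :=
    (measurableSet_eq_fun measurable_snd (hT'.comp measurable_fst)).compl
  have h1 := congrArg (fun V : Varifold n d => V {p : E n × Grass n d | p.2 ≠ T' p.1}) h
  beta_reduce at h1
  rw [Measure.map_apply (measurable_graph hT) hm, Measure.map_apply (measurable_graph hT') hm] at h1
  simpa [ae_iff, Filter.EventuallyEq] using h1

namespace IsRectifiableWith

variable {S : Set (E n)} {θ : E n → ℝ≥0} {T : E n → Grass n d} {V : Varifold n d}

theorem mass_eq (h : IsRectifiableWith S θ T V) :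
    mass V = (μH[(d : ℝ)].restrict S).withDensity fun x => (θ x : ℝ≥0∞) := by
  rw [h.eq_map, mass_map_graph h.measurable_tangent]

theorem eq_map_mass (h : IsRectifiableWith S θ T V) : V = (mass V).map fun x => (x, T x) := by
  rw [h.mass_eq]
  exact h.eq_map

/-- Together with `restrict_le`, this makes `‖V‖` and `ℋᵈ|_S` comparable, so that the Ahlfors and
tube bounds pass to `‖V‖`. -/
theorem mass_le (h : IsRectifiableWith S θ T V) {C : ℝ}
    (hθ : ∀ᵐ x ∂(μH[(d : ℝ)].restrict S), (θ x : ℝ) ≤ C) :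
    mass V ≤ ENNReal.ofReal C • μH[(d : ℝ)].restrict S := by
  rw [h.mass_eq, ← withDensity_const]
  refine withDensity_mono (hθ.mono fun x hx => ?_)
  beta_reduce
  rw [← ENNReal.ofReal_coe_nnreal]
  exact ENNReal.ofReal_le_ofReal hx

theorem restrict_le (h : IsRectifiableWith S θ T V) {C : ℝ} (hC : 0 < C)
    (hθ : ∀ᵐ x ∂(μH[(d : ℝ)].restrict S), C⁻¹ ≤ (θ x : ℝ)) :
    μH[(d : ℝ)].restrict S ≤ ENNReal.ofReal C • mass V := by
  rw [h.mass_eq, ← withDensity_smul_measure, withDensity_smul_measure,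
    ← withDensity_smul' _ _ ENNReal.ofReal_ne_top]
  nth_rw 1 [← withDensity_one (μ := μH[(d : ℝ)].restrict S)]
  refine withDensity_mono (hθ.mono fun x hx => ?_)
  simp only [Pi.one_apply, Pi.smul_apply, smul_eq_mul]
  rw [← ENNReal.ofReal_coe_nnreal, ← ENNReal.ofReal_mul hC.le, ENNReal.one_le_ofReal]
  calc (1 : ℝ) = C * C⁻¹ := (mul_inv_cancel₀ hC.ne').symm
    _ ≤ _ := by gcongr

end IsRectifiableWith

/-! ### Mass near the singular set and oscillation of the tangent planes. -/

namespace PiecewiseC1Data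

variable {β C R : ℝ} {S Sing : Set (E n)} {θ : E n → ℝ≥0} {T : E n → Grass n d}
  {μ : Measure (E n)}

theorem le_measure_ball (D : PiecewiseC1Data β C R S θ T Sing) (hC : 1 ≤ C)
    (hge : μH[(d : ℝ)].restrict S ≤ ENNReal.ofReal C • μ) {x : E n} (hx : x ∈ S) {r : ℝ}
    (hr : 0 < r) (hrR : r < R) :
    ENNReal.ofReal (r ^ d) ≤ ENNReal.ofReal (C ^ 2) * μ (Metric.ball x r) := by
  have hC0 : 0 < C := by linarith
  have h1 := hge (Metric.ball x r)
  rw [Measure.restrict_apply Metric.isOpen_ball.measurableSet, inter_comm, Measure.smul_apply,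
    smul_eq_mul] at h1
  calc ENNReal.ofReal (r ^ d) = ENNReal.ofReal C * ENNReal.ofReal (C⁻¹ * r ^ d) := by
        rw [← ENNReal.ofReal_mul hC0.le, mul_inv_cancel_left₀ hC0.ne']
    _ ≤ ENNReal.ofReal C * (ENNReal.ofReal C * μ (Metric.ball x r)) := by
        gcongr
        exact (D.ahlfors x hx r hr hrR).1.trans h1
    _ = _ := by rw [← mul_assoc, ← ENNReal.ofReal_mul hC0.le, pow_two]

theorem measure_tube_le (D : PiecewiseC1Data β C R S θ T Sing) (hC : 1 ≤ C)
    (hle : μ ≤ ENNReal.ofReal C • μH[(d : ℝ)].restrict S) {z : E n} (hz : z ∈ Sing) {t ε : ℝ}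
    (ht : 0 < t) (htε : t < ε) (hε : ε < R) :
    μ (Metric.thickening t Sing ∩ Metric.ball z ε)
      ≤ ENNReal.ofReal (C ^ 3 * t * ε ^ (d - 1)) := by
  have hC0 : 0 < C := by linarith
  have hε0 : 0 < ε := ht.trans htε
  refine (hle _).trans ?_
  rw [Measure.smul_apply, smul_eq_mul, Measure.restrict_apply
    (Metric.isOpen_thickening.measurableSet.inter Metric.isOpen_ball.measurableSet), inter_comm,
    ← inter_assoc]
  calc ENNReal.ofReal C * μH[(d : ℝ)] (S ∩ Metric.thickening t Sing ∩ Metric.ball z ε)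
      ≤ ENNReal.ofReal C * (ENNReal.ofReal (C * t) * ENNReal.ofReal (C * ε ^ (d - 1))) := by
        gcongr
        refine (D.tube t ε ht htε hε z hz).2.trans ?_
        gcongr
        exact (D.ahlfors_sing z hz ε hε0 hε).2
    _ = _ := by
        rw [← ENNReal.ofReal_mul (by positivity), ← ENNReal.ofReal_mul (by positivity)]
        congr 1
        ring

theorem exists_mem_of_mem_support (hle : μ ≤ ENNReal.ofReal C • μH[(d : ℝ)].restrict S)
    {x : E n} (hx : x ∈ μ.support) {r : ℝ} (hr : 0 < r) : ∃ y ∈ S, dist y x < r := by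
  have h1 : 0 < μ (Metric.ball x r) :=
    (Measure.mem_support_iff_forall _).1 hx _ (Metric.ball_mem_nhds x hr)
  by_contra! hcon
  refine h1.ne' (le_antisymm ((hle _).trans ?_) zero_le)
  rw [Measure.smul_apply, Measure.restrict_apply Metric.isOpen_ball.measurableSet]
  have : Metric.ball x r ∩ S = ∅ := by
    ext y
    simp only [mem_inter_iff, Metric.mem_ball, mem_empty_iff_false, iff_false, not_and]
    exact fun h hy => (hcon y hy).not_gt h
  simp [this]

/-- The part of a ball near the singular set has small mass relative to the ball. -/
theorem measure_thickening_inter_le (D : PiecewiseC1Data β C R S θ T Sing) (hC : 1 ≤ C)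
    (hd : 1 ≤ d) (hle : μ ≤ ENNReal.ofReal C • μH[(d : ℝ)].restrict S)
    (hge : μH[(d : ℝ)].restrict S ≤ ENNReal.ofReal C • μ) {x : E n} (hx : x ∈ μ.support)
    {r δ : ℝ} (hr : 0 < r) (hrR : 3 * r < R) (hδ : 0 < δ) (hδr : 10 * C * δ ≤ r) :
    μ (Metric.thickening (2 * δ) (Metric.ball x r) ∩ Metric.thickening (3 * C * δ) Sing)
      ≤ ENNReal.ofReal (6 ^ d * C ^ 6 * (δ / r)) * μ (Metric.ball x r) := by
  have hC0 : 0 < C := by linarith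
  have hδr' : 10 * δ ≤ r := by nlinarith
  have hsub := Metric.thickening_ball x (2 * δ) r
  rcases (Metric.thickening (2 * δ) (Metric.ball x r) ∩
    Metric.thickening (3 * C * δ) Sing).eq_empty_or_nonempty with h0 | ⟨y, hy1, hy2⟩
  · rw [h0, measure_empty]
    exact zero_le
  obtain ⟨z, hz, hyz⟩ := Metric.mem_thickening_iff.1 hy2
  have hyx : dist y x < 2 * δ + r := hsub hy1
  -- The radii add up to at most `2r + 4δ + 3Cδ`, and `10 C δ ≤ r` absorbs the last two terms.
  have hball : Metric.ball x (2 * δ + r) ⊆ Metric.ball z (3 * r) := by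
    refine Metric.ball_subset_ball' ?_
    have := dist_triangle_left x z y
    linarith
  -- A point of the support need not lie in `S`, so the lower Ahlfors bound is used at a nearby
  -- point of `S`, with half the radius.
  obtain ⟨x', hx', hxx'⟩ := exists_mem_of_mem_support hle hx (half_pos hr)
  have hlow := D.le_measure_ball hC hge hx' (half_pos hr) (by linarith)
  have hball' : Metric.ball x' (r / 2) ⊆ Metric.ball x r :=
    Metric.ball_subset_ball' (by linarith)
  calc μ (Metric.thickening (2 * δ) (Metric.ball x r) ∩ Metric.thickening (3 * C * δ) Sing)
      ≤ μ (Metric.thickening (3 * C * δ) Sing ∩ Metric.ball z (3 * r)) :=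
        measure_mono fun w hw => ⟨hw.2, hball (hsub hw.1)⟩
    _ ≤ ENNReal.ofReal (C ^ 3 * (3 * C * δ) * (3 * r) ^ (d - 1)) :=
        D.measure_tube_le hC hle hz (by positivity) (by linarith) hrR
    _ = ENNReal.ofReal (6 ^ d * C ^ 4 * (δ / r)) * ENNReal.ofReal ((r / 2) ^ d) := by
        rw [← ENNReal.ofReal_mul (by positivity)]
        congr 1
        obtain ⟨k, rfl⟩ : ∃ k, d = k + 1 := ⟨d - 1, by omega⟩
        rw [Nat.add_sub_cancel, mul_pow, div_pow, show (6 : ℝ) = 3 * 2 by norm_num, mul_pow]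
        field_simp
        ring
    _ ≤ ENNReal.ofReal (6 ^ d * C ^ 4 * (δ / r))
          * (ENNReal.ofReal (C ^ 2) * μ (Metric.ball x r)) := by
        gcongr
        exact hlow.trans (by gcongr)
    _ = _ := by
        rw [← mul_assoc, ← ENNReal.ofReal_mul (by positivity)]
        congr 2
        ring

/-- Without a finite net there is an infinite `ρ`-separated sequence in `A`. The balls of radius `ρ
/ 2` around it are disjoint and have mass bounded below, against the finiteness of `μ`. -/
theorem exists_finite_net (D : PiecewiseC1Data β C R S θ T Sing) (hC : 1 ≤ C)
    [IsFiniteMeasure μ] (hge : μH[(d : ℝ)].restrict S ≤ ENNReal.ofReal C • μ) {A : Set (E n)}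
    (hA : A ⊆ S) {ρ : ℝ} (hρ : 0 < ρ) (hρR : ρ < R) :
    ∃ t : Finset (E n), (∀ z ∈ t, z ∈ A) ∧ A ⊆ ⋃ z ∈ t, Metric.ball z ρ := by
  by_contra! hcon
  have : Std.Symm fun x y : E n => ρ ≤ dist x y := ⟨fun x y h => by rwa [dist_comm]⟩
  obtain ⟨f, hf, hfd⟩ := exists_seq_of_forall_finset_exists' (· ∈ A)
    (fun x y : E n => ρ ≤ dist x y) fun t ht => by
      obtain ⟨y, hy, hyt⟩ := not_subset.1 (hcon t ht)
      refine ⟨y, hy, fun x hx => ?_⟩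
      by_contra! hlt
      exact hyt (mem_biUnion hx (by rwa [Metric.mem_ball, dist_comm]))
  have hC0 : 0 < C := by linarith
  have hpos : 0 < ENNReal.ofReal ((ρ / 2) ^ d) / ENNReal.ofReal (C ^ 2) :=
    ENNReal.div_pos (by simpa using by positivity) ENNReal.ofReal_ne_top
  have hfin := Measure.finite_const_le_meas_of_disjoint_iUnion μ hpos
    (As := fun k => Metric.ball (f k) (ρ / 2)) (fun k => Metric.isOpen_ball.measurableSet)
    (fun i j hij => Metric.ball_disjoint_ball (by linarith [hfd hij])) (measure_ne_top _ _)
  refine infinite_univ (hfin.subset fun k _ => ?_)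
  exact ENNReal.div_le_of_le_mul'
    (D.le_measure_ball hC hge (hA (hf k)) (half_pos hρ) (by linarith))

/-- A finite net makes `S` bounded. Hence finitely many cells can carry the whole mass, and the
rates need no term for lost mass. -/
theorem exists_measure_compl_ball_eq_zero (D : PiecewiseC1Data β C R S θ T Sing) (hC : 1 ≤ C)
    (hR : 0 < R) [IsFiniteMeasure μ] (hle : μ ≤ ENNReal.ofReal C • μH[(d : ℝ)].restrict S)
    (hge : μH[(d : ℝ)].restrict S ≤ ENNReal.ofReal C • μ) :
    ∃ r, μ (Metric.ball 0 r)ᶜ = 0 := by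
  obtain ⟨t, -, ht⟩ := D.exists_finite_net hC hge subset_rfl (half_pos hR) (by linarith)
  have hb : Bornology.IsBounded S :=
    ((Bornology.isBounded_biUnion_finset t).2 fun _ _ => Metric.isBounded_ball).subset ht
  obtain ⟨r, hr⟩ := hb.subset_ball (0 : E n)
  refine ⟨r, le_antisymm ((hle _).trans ?_) zero_le⟩
  rw [Measure.smul_apply, Measure.restrict_apply Metric.isOpen_ball.measurableSet.compl,
    disjoint_iff_inter_eq_empty.1 (disjoint_compl_left_iff_subset.2 hr)]
  simp

/-- Balls of radius `2ρ` around a finite `ρ`-net of `Σ` cover the tube, and `measure_tube_le`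
applies in each. -/
theorem exists_measure_thickening_le (D : PiecewiseC1Data β C R S θ T Sing) (hC : 1 ≤ C)
    [IsFiniteMeasure μ] (hle : μ ≤ ENNReal.ofReal C • μH[(d : ℝ)].restrict S)
    (hge : μH[(d : ℝ)].restrict S ≤ ENNReal.ofReal C • μ) {ρ : ℝ} (hρ : 0 < ρ)
    (hρR : 2 * ρ < R) :
    ∃ M : ℝ, 0 ≤ M ∧ ∀ t, 0 < t → t < ρ →
      μ (Metric.thickening t Sing) ≤ ENNReal.ofReal (M * t) := by
  obtain ⟨N, hN, hcov⟩ := D.exists_finite_net hC hge D.sing_subset hρ (by linarith)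
  refine ⟨N.card * (C ^ 3 * (2 * ρ) ^ (d - 1)), by positivity, fun t ht htρ => ?_⟩
  have hsub : Metric.thickening t Sing
      ⊆ ⋃ z ∈ N, (Metric.thickening t Sing ∩ Metric.ball z (2 * ρ)) := by
    intro y hy
    obtain ⟨w, hw, hyw⟩ := Metric.mem_thickening_iff.1 hy
    obtain ⟨z, hz, hwz⟩ := mem_iUnion₂.1 (hcov hw)
    refine mem_iUnion₂.2 ⟨z, hz, hy, ?_⟩
    have := dist_triangle y w z
    rw [Metric.mem_ball] at hwz ⊢
    linarith
  calc μ (Metric.thickening t Sing)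
      ≤ ∑ z ∈ N, μ (Metric.thickening t Sing ∩ Metric.ball z (2 * ρ)) :=
        (measure_mono hsub).trans (measure_biUnion_finset_le _ _)
    _ ≤ ∑ z ∈ N, ENNReal.ofReal (C ^ 3 * t * (2 * ρ) ^ (d - 1)) :=
        Finset.sum_le_sum fun z hz =>
          D.measure_tube_le hC hle (hN z hz) ht (by linarith) hρR
    _ = _ := by
        rw [Finset.sum_const, nsmul_eq_mul, ← ENNReal.ofReal_natCast,
          ← ENNReal.ofReal_mul (by positivity)]
        congr 1
        ring

/-- On a small cell, the tangent planes are nearly constant unless the cell is close to the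
singular set. -/
theorem ae_edist_le_or_measure_diff_eq_zero (D : PiecewiseC1Data β C R S θ T Sing) (hC : 1 ≤ C)
    (hle : μ ≤ ENNReal.ofReal C • μH[(d : ℝ)].restrict S) {T₀ : E n → Grass n d}
    (hT₀ : T₀ =ᵐ[μ] T) {δ : ℝ} (hδ : 0 < δ) (hδR : 2 * δ < R) {K : Set (E n)}
    (hK : MeasurableSet K) (hKδ : Metric.ediam K ≤ ENNReal.ofReal δ) :
    (∀ᵐ x ∂μ.restrict K, ∀ᵐ y ∂μ.restrict K,
        edist (T₀ y) (T₀ x) ≤ ENNReal.ofReal (C * (2 * δ) ^ β)) ∨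
      μ (K \ Metric.thickening (3 * C * δ) Sing) = 0 := by
  have hC0 : 0 < C := by linarith
  have hac : μ ≪ μH[(d : ℝ)].restrict S :=
    (Measure.absolutelyContinuous_of_le hle).trans (Measure.smul_absolutelyContinuous)
  by_cases hgood : ∃ x ∈ K ∩ S, x ∉ Metric.thickening (3 * C * δ) Sing
  · left
    obtain ⟨x, ⟨hxK, hxS⟩, hx⟩ := hgood
    -- The Hölder condition is used on the ball of radius `2δ`, which needs distance more than
    -- `2Cδ`; the tube has width `3Cδ` to make this strict.
    have hfar : ENNReal.ofReal (C * (2 * δ)) < Metric.infEDist x Sing := by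
      rw [Metric.thickening, mem_ofPred_eq, not_lt] at hx
      refine lt_of_lt_of_le ((ENNReal.ofReal_lt_ofReal_iff (by positivity)).2 ?_) hx
      nlinarith
    have hKb : K ⊆ Metric.ball x (2 * δ) := by
      intro y hy
      have := (Metric.edist_le_ediam_of_mem hy hxK).trans hKδ
      rw [edist_dist, ENNReal.ofReal_le_ofReal_iff hδ.le] at this
      rw [Metric.mem_ball]
      linarith
    have hacK : μ.restrict K ≪ μH[(d : ℝ)].restrict (S ∩ Metric.ball x (2 * δ)) := by
      refine (hac.restrict K).trans ?_
      rw [Measure.restrict_restrict hK, inter_comm]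
      exact Measure.absolutelyContinuous_of_le
        (Measure.restrict_mono (inter_subset_inter_right _ hKb) le_rfl)
    have hT₀K : ∀ᵐ x ∂μ.restrict K, T₀ x = T x := ae_restrict_of_ae hT₀
    have := hacK.ae_le (D.tangent_holder (2 * δ) (by linarith) hδR x hxS hfar)
    filter_upwards [this, hT₀K] with y hy hyT
    filter_upwards [hacK.ae_le hy, hT₀K] with z hz hzT
    rw [hyT, hzT, edist_comm, edist_dist]
    exact ENNReal.ofReal_le_ofReal hz
  · right
    push Not at hgood
    refine hac ?_
    rw [Measure.restrict_apply (hK.diff Metric.isOpen_thickening.measurableSet)]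
    have h0 : K \ Metric.thickening (3 * C * δ) Sing ∩ S = ∅ :=
      eq_empty_of_forall_notMem fun x hx => hx.1.2 (hgood x ⟨hx.1.1, hx.2⟩)
    rw [h0, measure_empty]

end PiecewiseC1Data

/-! ### Rates for piecewise `C^{1,β}` varifolds. -/

namespace PiecewiseC1Data

variable {β C R : ℝ} {S Sing : Set (E n)} {θ : E n → ℝ≥0} {T : E n → Grass n d}
  {μ : Measure (E n)}

/-- The bounded Lipschitz distance to a fine discretization in terms of the mass near the singular
set. -/
theorem flatDist_le (D : PiecewiseC1Data β C R S θ T Sing) (hC : 1 ≤ C) (hβ1 : β ≤ 1)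
    [IsFiniteMeasure μ] (hle : μ ≤ ENNReal.ofReal C • μH[(d : ℝ)].restrict S)
    {T₀ : E n → Grass n d} (hT₀m : Measurable T₀) (hT₀ : T₀ =ᵐ[μ] T) {δ : ℝ} (hδ : 0 < δ)
    (hδR : 2 * δ < R) (hδ1 : δ ≤ 1) {s : Finset (Set (E n))} {ν : Set (E n) → Measure (E n)}
    {P : Set (E n) → Grass n d} (h : IsDiscretization μ T₀ δ s ν P)
    (hs : μ (⋃ K ∈ s, K)ᶜ = 0) (U : Set (E n)) :
    flatDist U (cellVarifold μ s ν P) (μ.map fun x => (x, T₀ x))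
      ≤ ENNReal.ofReal ((1 + 2 * C) * δ ^ β) * μ (Metric.thickening (2 * δ) U)
        + 2 * μ (Metric.thickening (2 * δ) U ∩ Metric.thickening (3 * C * δ) Sing) := by
  have hC0 : 0 < C := by linarith
  refine (h.flatDist_le_of_bad hT₀m hs hδ U (fun K hK =>
    D.ae_edist_le_or_measure_diff_eq_zero hC hle hT₀ hδ hδR (h.measurable K hK)
      (h.ediam_le K hK)) Metric.isOpen_thickening.measurableSet).trans ?_
  rw [← ENNReal.ofReal_add hδ.le (by positivity)]
  gcongr
  have h1 : δ ≤ δ ^ β := by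
    simpa using Real.rpow_le_rpow_of_exponent_ge hδ hδ1 hβ1
  have h2 : (2 * δ) ^ β ≤ 2 * δ ^ β := by
    rw [Real.mul_rpow zero_le_two hδ.le]
    gcongr
    simpa using Real.rpow_le_rpow_of_exponent_le one_le_two hβ1
  nlinarith

end PiecewiseC1Data

/-- The set, multiplicity and planes in `IsPiecewiseC1` need not be those the discretization was
built from. Both represent the same varifold, so the masses agree and the planes agree almost
everywhere. -/
theorem IsPiecewiseC1.exists_data {β : ℝ} {μ : Measure (E n)} {T₀ : E n → Grass n d}
    (hT₀ : Measurable T₀) (h : IsPiecewiseC1 β (μ.map fun x => (x, T₀ x))) :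
    ∃ (S : Set (E n)) (θ : E n → ℝ≥0) (T : E n → Grass n d) (R C : ℝ) (Sing : Set (E n)),
      0 < R ∧ 1 ≤ C ∧ PiecewiseC1Data β C R S θ T Sing ∧ T₀ =ᵐ[μ] T ∧
      μ ≤ ENNReal.ofReal C • μH[(d : ℝ)].restrict S ∧
      μH[(d : ℝ)].restrict S ≤ ENNReal.ofReal C • μ := by
  obtain ⟨S, θ, T, hrect, R, C, Sing, hR, hC, D⟩ := h
  have h1 := hrect.mass_le (D.mult_bounds.mono fun x hx => hx.2)
  have h2 := hrect.restrict_le (by linarith) (D.mult_bounds.mono fun x hx => hx.1)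
  have h3 := hrect.eq_map_mass
  rw [mass_map_graph hT₀] at h1 h2 h3
  exact ⟨S, θ, T, R, C, Sing, hR, hC, D,
    ae_eq_of_map_graph_eq hT₀ hrect.measurable_tangent h3, h1, h2⟩

theorem IsPiecewiseC1.exists_measure_compl_ball_eq_zero {β : ℝ} {μ : Measure (E n)}
    [IsFiniteMeasure μ] {T₀ : E n → Grass n d} (hT₀ : Measurable T₀)
    (h : IsPiecewiseC1 β (μ.map fun x => (x, T₀ x))) : ∃ r, μ (Metric.ball 0 r)ᶜ = 0 := by
  obtain ⟨S, θ, T, R, C, Sing, hR, hC, D, -, hle, hge⟩ := h.exists_data hT₀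
  exact D.exists_measure_compl_ball_eq_zero hC hR hle hge

/-- The rates of approximation of a piecewise `C^{1,β}` varifold by discretizations. -/
theorem IsPiecewiseC1.exists_rate (hd : 1 ≤ d) {β : ℝ} (hβ1 : β ≤ 1)
    {μ : Measure (E n)} [IsFiniteMeasure μ] {T₀ : E n → Grass n d} (hT₀ : Measurable T₀)
    (h : IsPiecewiseC1 β (μ.map fun x => (x, T₀ x))) :
    ∃ C R : ℝ, 0 < C ∧ 0 < R ∧ ∀ (δ : ℝ) (s : Finset (Set (E n)))
      (ν : Set (E n) → Measure (E n)) (P : Set (E n) → Grass n d), 0 < δ →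
      IsDiscretization μ T₀ δ s ν P → μ (⋃ K ∈ s, K)ᶜ = 0 →
      (∀ x ∈ μ.support, ∀ r : ℝ, 0 < r → r < R →
        flatDist (Metric.ball x r) (cellVarifold μ s ν P) (μ.map fun x => (x, T₀ x))
          ≤ ENNReal.ofReal (C * (δ ^ β + δ / (r + δ)))
            * μ (Metric.thickening (C * δ) (Metric.ball x r))) ∧
      flatDist univ (cellVarifold μ s ν P) (μ.map fun x => (x, T₀ x))
        ≤ ENNReal.ofReal (C * (δ ^ β + δ / R)) * μ univ := by
  obtain ⟨S, θ, T, R, C, Sing, hR, hC, D, hTT, hle, hge⟩ := h.exists_data hT₀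
  have hC0 : 0 < C := by linarith
  -- The bound `R / 4` leaves room for balls of radius `3r`; the bound `1` ensures `δ ≤ δ ^ β` for
  -- fine meshes.
  set ρ := min (R / 4) 1 with hρ
  have hρ0 : 0 < ρ := by positivity
  have hρR : ρ ≤ R / 4 := min_le_left _ _
  have hρ1 : ρ ≤ 1 := min_le_right _ _
  obtain ⟨M, hM, hMt⟩ := D.exists_measure_thickening_le hC hle hge hρ0 (by linarith)
  set m := (μ univ).toReal
  have hm0 : 0 ≤ m := ENNReal.toReal_nonneg
  -- The summands serve in turn the coarse case, where `2 (r + δ) ≤ (20C + 2) δ`, together with the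
  -- factor `1 + 2C` of `δ ^ β`; the tube inside a ball, with `δ / r ≤ 2δ / (r + δ)`; and the whole
  -- tube, measured against the total mass `m`.
  set C' := 20 * C + 2 + 4 * 6 ^ d * C ^ 6 + 6 * C * M * ρ / m with hC'
  have e1 : 0 ≤ 4 * 6 ^ d * C ^ 6 := by positivity
  have e2 : 0 ≤ 6 * C * M * ρ / m := by positivity
  have hC'0 : 0 < C' := by linarith
  have hC'2 : 20 * C + 2 ≤ C' := by linarith
  refine ⟨C', ρ, hC'0, hρ0, fun δ s ν P hδ hdisc hs => ⟨fun x hx r hr hrρ => ?_, ?_⟩⟩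
  · have hthick : Metric.thickening (2 * δ) (Metric.ball x r)
        ⊆ Metric.thickening (C' * δ) (Metric.ball x r) :=
      Metric.thickening_mono (by gcongr; linarith) _
    have hδβ : 0 ≤ δ ^ β := by positivity
    rcases lt_or_ge r (10 * C * δ) with hlt | hge'
    · refine (hdisc.flatDist_le_two_mul hT₀ hs hδ _).trans ?_
      gcongr
      rw [show (2 : ℝ≥0∞) = ENNReal.ofReal 2 by simp]
      refine ENNReal.ofReal_le_ofReal ?_
      have h1 : 2 ≤ C' * (δ / (r + δ)) := by
        rw [mul_div_assoc', le_div_iff₀ (by positivity)]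
        nlinarith
      nlinarith
    · have hδr : 10 * δ ≤ r := by nlinarith
      refine (D.flatDist_le hC hβ1 hle hT₀ hTT hδ (by linarith) (by linarith) hdisc hs
        _).trans ?_
      calc ENNReal.ofReal ((1 + 2 * C) * δ ^ β) * μ (Metric.thickening (2 * δ) (Metric.ball x r))
            + 2 * μ (Metric.thickening (2 * δ) (Metric.ball x r)
              ∩ Metric.thickening (3 * C * δ) Sing)
          ≤ ENNReal.ofReal ((1 + 2 * C) * δ ^ β)
              * μ (Metric.thickening (C' * δ) (Metric.ball x r))
            + 2 * (ENNReal.ofReal (6 ^ d * C ^ 6 * (δ / r))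
              * μ (Metric.thickening (C' * δ) (Metric.ball x r))) := by
            gcongr
            refine (D.measure_thickening_inter_le hC hd hle hge hx hr (by linarith) hδ
              hge').trans ?_
            gcongr
            exact Metric.self_subset_thickening (by positivity) _
        _ = ENNReal.ofReal ((1 + 2 * C) * δ ^ β + 2 * (6 ^ d * C ^ 6 * (δ / r)))
              * μ (Metric.thickening (C' * δ) (Metric.ball x r)) := by
            rw [ENNReal.ofReal_add (by positivity) (by positivity),
              ENNReal.ofReal_mul zero_le_two, ENNReal.ofReal_ofNat]
            ring
        _ ≤ _ := by
            gcongr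
            have h1 : δ / r ≤ 2 * (δ / (r + δ)) := by
              rw [mul_div_assoc', div_le_div_iff₀ hr (by positivity)]
              nlinarith
            have h2 : 2 * (6 ^ d * C ^ 6 * (δ / r)) ≤ 4 * 6 ^ d * C ^ 6 * (δ / (r + δ)) := by
              calc 2 * (6 ^ d * C ^ 6 * (δ / r))
                  ≤ 2 * (6 ^ d * C ^ 6 * (2 * (δ / (r + δ)))) := by gcongr
                _ = _ := by ring
            rw [mul_add]
            refine add_le_add (by gcongr; linarith) (h2.trans ?_)
            gcongr
            linarith
  · have hδβ : 0 ≤ δ ^ β := by positivity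
    have htriv := hdisc.flatDist_le_two_mul hT₀ hs hδ univ
    rcases eq_or_ne (μ univ) 0 with h0 | h0
    · refine htriv.trans ?_
      rw [measure_mono_null (subset_univ _) h0]
      simp
    have hm : 0 < m := ENNReal.toReal_pos h0 (measure_ne_top _ _)
    have hμm : μ univ = ENNReal.ofReal m := (ENNReal.ofReal_toReal (measure_ne_top _ _)).symm
    rcases lt_or_ge ρ (10 * C * δ) with hlt | hge'
    · refine htriv.trans ?_
      refine mul_le_mul' ?_ (measure_mono (subset_univ _))
      rw [show (2 : ℝ≥0∞) = ENNReal.ofReal 2 by simp]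
      refine ENNReal.ofReal_le_ofReal ?_
      have h1 : 2 ≤ C' * (δ / ρ) := by
        rw [mul_div_assoc', le_div_iff₀ hρ0]
        nlinarith
      nlinarith
    · have hδρ : 10 * δ ≤ ρ := by nlinarith
      refine (D.flatDist_le hC hβ1 hle hT₀ hTT hδ (by linarith) (by linarith) hdisc hs
        _).trans ?_
      calc ENNReal.ofReal ((1 + 2 * C) * δ ^ β) * μ (Metric.thickening (2 * δ) univ)
            + 2 * μ (Metric.thickening (2 * δ) univ ∩ Metric.thickening (3 * C * δ) Sing)
          ≤ ENNReal.ofReal ((1 + 2 * C) * δ ^ β) * μ univ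
            + 2 * ENNReal.ofReal (M * (3 * C * δ)) := by
            gcongr
            · exact subset_univ _
            · exact (measure_mono inter_subset_right).trans
                (hMt _ (by positivity) (by nlinarith))
        _ = ENNReal.ofReal (((1 + 2 * C) * δ ^ β + 6 * C * M * ρ / m * (δ / ρ)) * m) := by
            rw [hμm, ← ENNReal.ofReal_ofNat, ← ENNReal.ofReal_mul (by positivity),
              ← ENNReal.ofReal_mul zero_le_two,
              ← ENNReal.ofReal_add (by positivity) (by positivity)]
            congr 1
            field_simp
            ring
        _ ≤ ENNReal.ofReal (C' * (δ ^ β + δ / ρ) * m) := by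
            gcongr
            rw [mul_add]
            refine add_le_add (by gcongr; linarith) ?_
            gcongr
            linarith
        _ = _ := by rw [hμm, ENNReal.ofReal_mul (by positivity)]

/-! ### Meshes and the construction of the approximating sequence. -/

namespace Mesh

theorem ediam_le_size (𝒦 : Mesh n) {K : Set (E n)} (hK : K ∈ 𝒦.cells) :
    Metric.ediam K ≤ 𝒦.size := le_iSup₂ (f := fun K (_ : K ∈ 𝒦.cells) => Metric.ediam K) K hK

/-- In a mesh of size zero every cell is a point, and local finiteness would make the unit ball
finite. The rate estimates rely on `δ > 0`. -/
theorem size_ne_zero (𝒦 : Mesh n) (hn : 0 < n) : 𝒦.size ≠ 0 := by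
  intro h0
  have : Nonempty (Fin n) := ⟨⟨0, hn⟩⟩
  have hsub : ∀ K ∈ 𝒦.cells, K.Subsingleton := fun K hK =>
    Metric.ediam_eq_zero_iff.1 (le_antisymm ((𝒦.ediam_le_size hK).trans h0.le) zero_le)
  have hfin := 𝒦.locallyFinite (Metric.ball 0 1) Metric.isBounded_ball
  have hball : (Metric.ball (0 : E n) 1).Finite := by
    refine (hfin.biUnion fun K hK => (hsub K hK.1).finite).subset fun x hx => ?_
    obtain ⟨K, hK, hxK⟩ := mem_sUnion.1 (𝒦.cover.symm ▸ mem_univ x : x ∈ ⋃₀ 𝒦.cells)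
    exact mem_iUnion₂.2 ⟨K, ⟨hK, x, hxK, hx⟩, hxK⟩
  have hnhds : Metric.ball (0 : E n) 1 ∈ 𝓝 0 := Metric.ball_mem_nhds _ one_pos
  exact infinite_of_mem_nhds (0 : E n) hnhds hball

end Mesh

theorem tendsto_measure_compl_ball (μ : Measure (E n)) [IsFiniteMeasure μ] :
    Tendsto (fun i : ℕ => μ (Metric.ball 0 (i : ℝ))ᶜ) atTop (𝓝 0) := by
  have h := tendsto_measure_iInter_atTop (μ := μ) (s := fun i : ℕ => (Metric.ball (0 : E n) i)ᶜ)
    (fun i => Metric.isOpen_ball.measurableSet.compl.nullMeasurableSet)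
    (fun i j hij => compl_subset_compl.2 (Metric.ball_subset_ball (Nat.cast_le.2 hij)))
    ⟨0, measure_ne_top _ _⟩
  rwa [← compl_iUnion, Metric.iUnion_ball_nat, compl_univ, measure_empty] at h

/-- Discretizations of a finite mass on meshes of sizes `δ`, with planes that do not depend on the
reference measures, approximate the varifold. -/
theorem exists_cellVarifold_approximates (hd : 1 ≤ d) (hn : 0 < n) (𝒦 : ℕ → Mesh n)
    {δ : ℕ → ℝ≥0} (hδ : ∀ i, (𝒦 i).size = (δ i : ℝ≥0∞)) (μ : Measure (E n)) [IsFiniteMeasure μ]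
    {T : E n → Grass n d} (hT : Measurable T) :
    ∃ (s : ℕ → Finset (Set (E n))) (P : ℕ → Set (E n) → Grass n d),
      (∀ i, ∀ K ∈ s i, K ∈ (𝒦 i).cells) ∧
      ∀ ν : ℕ → Set (E n) → Measure (E n),
        (∀ i, ∀ K ∈ s i, IsProbabilityMeasure (ν i K) ∧ ν i K Kᶜ = 0) →
        Approximates δ (fun i => cellVarifold μ (s i) (ν i) (P i)) (μ.map fun x => (x, T x)) := by
  -- A radius that carries all the mass if there is one, and `0` otherwise.
  obtain ⟨ρ, hρ⟩ : ∃ ρ : ℝ, (∃ r, μ (Metric.ball 0 r)ᶜ = 0) → μ (Metric.ball 0 ρ)ᶜ = 0 := by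
    by_cases h : ∃ r, μ (Metric.ball 0 r)ᶜ = 0
    · exact ⟨h.choose, fun _ => h.choose_spec⟩
    · exact ⟨0, fun h' => absurd h' h⟩
  -- The radius `i` makes the lost mass tend to zero; the radius `ρ` makes it vanish for every `i`
  -- in the piecewise regular case.
  have hfin : ∀ i : ℕ, {K ∈ (𝒦 i).cells | (K ∩ Metric.ball 0 (max (i : ℝ) ρ)).Nonempty}.Finite :=
    fun i => (𝒦 i).locallyFinite _ Metric.isBounded_ball
  choose P hP using exists_mul_lintegral_edist_le μ hT
  refine ⟨fun i => (hfin i).toFinset, fun _ => P,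
    fun i K hK => ((hfin i).mem_toFinset.1 hK).1, fun ν hν => ?_⟩
  have hδ0 : ∀ i, 0 < (δ i : ℝ) := fun i => by
    have := (𝒦 i).size_ne_zero hn
    rw [hδ] at this
    simpa [pos_iff_ne_zero] using this
  have hdisc : ∀ i, IsDiscretization μ T (δ i) (hfin i).toFinset (ν i) P := fun i =>
    { disjoint := (𝒦 i).disjoint.subset fun K hK =>
        ((hfin i).mem_toFinset.1 (Finset.mem_coe.1 hK)).1
      measurable := fun K hK => (𝒦 i).measurable K ((hfin i).mem_toFinset.1 hK).1
      ediam_le := fun K hK => by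
        rw [ENNReal.ofReal_coe_nnreal, ← hδ]
        exact (𝒦 i).ediam_le_size ((hfin i).mem_toFinset.1 hK).1
      reference := hν i
      plane := hP }
  have hcompl : ∀ i, (⋃ K ∈ (hfin i).toFinset, K)ᶜ ⊆ (Metric.ball 0 (max (i : ℝ) ρ))ᶜ := by
    intro i
    refine compl_subset_compl.2 fun x hx => ?_
    obtain ⟨K, hK, hxK⟩ := mem_sUnion.1 ((𝒦 i).cover.symm ▸ mem_univ x : x ∈ ⋃₀ (𝒦 i).cells)
    exact mem_iUnion₂.2 ⟨K, (hfin i).mem_toFinset.2 ⟨hK, x, hxK, hx⟩, hxK⟩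
  refine ⟨fun hlim => ?_, fun β _ hβ1 hpw => ?_⟩
  · rw [ENNReal.tendsto_nhds_zero]
    intro ε hε
    -- The budget: `η` each for `δ i` and the oscillation of `A`, both times `μ univ`, then `2η` for
    -- `T - A` and `η` for the lost mass.
    obtain ⟨η, hη, hηε⟩ := ENNReal.exists_nnreal_pos_mul_lt
      (a := 2 * μ univ + 3) (by finiteness) hε.ne'
    obtain ⟨A, hA, hAT⟩ := exists_uniformContinuous_lintegral_enorm_sub_le μ hT
      (ε := (η : ℝ≥0∞)) (by simpa using hη.ne')
    obtain ⟨κ, hκ, hAκ⟩ := EMetric.uniformContinuous_iff.1 hA η (by simpa using hη)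
    have hlim' : Tendsto (fun i => (δ i : ℝ≥0∞)) atTop (𝓝 0) :=
      ENNReal.tendsto_coe.2 hlim
    filter_upwards [hlim'.eventually_lt_const hκ,
      hlim'.eventually_lt_const (show (0 : ℝ≥0∞) < η by simpa using hη),
      (tendsto_measure_compl_ball μ).eventually_lt_const (show (0 : ℝ≥0∞) < η by simpa using hη)]
      with i h1 h2 h3
    refine ((hdisc i).flatDist_univ_le_of_approx hT hA.continuous (ω := η) fun x y hxy =>
      (hAκ (hxy.trans_lt (by rwa [ENNReal.ofReal_coe_nnreal]))).le).trans ?_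
    rw [ENNReal.ofReal_coe_nnreal]
    have h4 : μ (⋃ K ∈ (hfin i).toFinset, K)ᶜ ≤ η := by
      refine (measure_mono ((hcompl i).trans ?_)).trans h3.le
      exact compl_subset_compl.2 (Metric.ball_subset_ball (le_max_left _ _))
    calc ((δ i : ℝ≥0∞) + η) * μ univ + 2 * ∫⁻ x, ‖(T x).proj - A x‖ₑ ∂μ
          + μ (⋃ K ∈ (hfin i).toFinset, K)ᶜ
        ≤ (η + η) * μ univ + 2 * η + η := by gcongr
      _ = η * (2 * μ univ + 3) := by ring
      _ ≤ ε := hηε.le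
  · obtain ⟨C, R, hC, hR, hrate⟩ := hpw.exists_rate hd hβ1 hT
    refine ⟨C, R, hC, hR, fun i => ?_⟩
    rw [mass_map_graph hT]
    refine hrate _ _ _ _ (hδ0 i) (hdisc i) (measure_mono_null ((hcompl i).trans ?_)
      (hρ (hpw.exists_measure_compl_ball_eq_zero hT)))
    exact compl_subset_compl.2 (Metric.ball_subset_ball (le_max_right _ _))

theorem cellVarifold_isPointCloud {𝒦 : Mesh n} {μ : Measure (E n)} [IsFiniteMeasure μ]
    {s : Finset (Set (E n))} (hs : ∀ K ∈ s, K ∈ 𝒦.cells) {x : Set (E n) → E n}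
    (hx : ∀ K ∈ s, x K ∈ K) (P : Set (E n) → Grass n d) :
    IsPointCloud 𝒦 (cellVarifold μ s (fun K => Measure.dirac (x K)) P) := by
  refine ⟨s, x, fun K => (μ K).toNNReal, P, fun K hK => ⟨hs K hK, hx K hK⟩, ?_⟩
  refine Finset.sum_congr rfl fun K _ => ?_
  rw [Measure.dirac_prod_dirac, ENNReal.coe_toNNReal (measure_ne_top _ _)]

theorem cellVarifold_isVolumetric {𝒦 : Mesh n} {μ : Measure (E n)} [IsFiniteMeasure μ]
    {s : Finset (Set (E n))} (hs : ∀ K ∈ s, K ∈ 𝒦.cells) (P : Set (E n) → Grass n d) :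
    IsVolumetric 𝒦 (cellVarifold μ s (fun K => (volume K)⁻¹ • volume.restrict K) P) := by
  refine ⟨s, fun K => (μ K).toNNReal, P, hs, ?_⟩
  refine Finset.sum_congr rfl fun K _ => ?_
  rw [Measure.prod_smul_left, smul_smul, ENNReal.coe_toNNReal (measure_ne_top _ _),
    div_eq_mul_inv]

end DiscreteVarifold

/-! ### The theorem, for both kinds of reference measures. -/

open DiscreteVarifold

theorem theorem6p3 (n d : ℕ) (hd : 1 ≤ d) (hdn : d < n)
    (𝒦 : ℕ → DiscreteVarifold.Mesh n) (δ : ℕ → ℝ≥0) (hδ : ∀ i, (𝒦 i).size = (δ i : ℝ≥0∞))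
    (V : DiscreteVarifold.Varifold n d) (hV : DiscreteVarifold.IsRectifiable V)
    (hfin : DiscreteVarifold.mass V Set.univ < ⊤) :
    ((∀ i, ∀ K ∈ (𝒦 i).cells, volume K ≠ 0) →
      ∃ W : ℕ → DiscreteVarifold.Varifold n d,
        (∀ i, DiscreteVarifold.IsVolumetric (𝒦 i) (W i)) ∧
        DiscreteVarifold.Approximates δ W V) ∧
    (∃ W : ℕ → DiscreteVarifold.Varifold n d,
      (∀ i, DiscreteVarifold.IsPointCloud (𝒦 i) (W i)) ∧
      DiscreteVarifold.Approximates δ W V) := by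

  obtain ⟨M, θ, T, hrect⟩ := hV
  have hVμ := hrect.eq_map_mass
  have hT := hrect.measurable_tangent
  have : IsFiniteMeasure (mass V) := ⟨hfin⟩
  obtain ⟨s, P, hs, happ⟩ := exists_cellVarifold_approximates hd (by omega) 𝒦 hδ (mass V) hT
  rw [← hVμ] at happ
  refine ⟨fun hvol => ⟨_, fun i => cellVarifold_isVolumetric (hs i) (P i),
    happ (fun _ K => (volume K)⁻¹ • volume.restrict K) fun i K hK => ?_⟩, ?_⟩
  · have hKm := (𝒦 i).measurable K (hs i K hK)
    -- Cells have finite diameter, hence finite volume, so Lebesgue measure on them can be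
    -- normalized.
    have hfinK : volume K ≠ ⊤ := by
      refine (Bornology.IsBounded.measure_lt_top (Metric.isBounded_iff_ediam_ne_top.2 ?_)).ne
      exact ne_top_of_le_ne_top (by rw [hδ]; exact ENNReal.coe_ne_top)
        ((𝒦 i).ediam_le_size (hs i K hK))
    refine ⟨⟨?_⟩, ?_⟩
    · simp [ENNReal.inv_mul_cancel (hvol i K (hs i K hK)) hfinK]
    · simp [Measure.restrict_apply hKm.compl]
  · have hne : ∀ i, ∀ K : Set (E n), ∃ x : E n, K ∈ s i → x ∈ K := fun i K => by
      by_cases hK : K ∈ s i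
      · exact ((𝒦 i).nonempty K (hs i K hK)).imp fun _ h _ => h
      · exact ⟨0, fun h => absurd h hK⟩
    choose x hx using hne
    refine ⟨_, fun i => cellVarifold_isPointCloud (hs i) (fun K hK => hx i K hK) (P i),
      happ (fun i K => Measure.dirac (x i K)) fun i K hK => ⟨inferInstance, ?_⟩⟩
    rw [Measure.dirac_apply' _ ((𝒦 i).measurable K (hs i K hK)).compl]
    simp [hx i K hK]
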